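/- Let $\mathcal{M}\subset\mathbb{R}^{d\times r}$ be a compact smooth ($C^\infty$) embedded submanifold without boundary, where $\mathbb{R}^{d\times r}$ carries the Euclidean (Frobenius) inner product and norm $\|\cdot\|$. For $y\in\mathbb{R}^{d\times r}$ let $\mathrm{dist}(y,\mathcal{M})=\inf_{z\in\mathcal{M}}\|z-y\|$ and let $\mathcal{P}_{\mathcal{M}}(y)=\arg\min_{z\in\mathcal{M}}\|z-y\|$ be the nearest-point projection. Let $\gamma>0$ be such that $\mathcal{M}$ is $2\gamma$-proximally smooth, i.e. $\mathcal{P}_{\mathcal{M}}(y)$ is a singleton for every $y$ with $\mathrm{dist}(y,\mathcal{M})<2\gamma$. For $x\in\mathcal{M}$ let $\mathcal{P}_{T_x\mathcal{M}}$ be the orthogonal projection onto the tangent space $T_x\mathcal{M}\subset\mathbb{R}^{d\times r}$. Lemma (Lipschitz-type inequality for the projection operator). There is a constant $Q$ (depending only on $\mathcal{M}$ and $\gamma$) such that for every $x\in\mathcal{M}$ and every $u\in\mathbb{R}^{d\times r}$ with $\|u\|\le\gamma$, the set $\mathcal{P}_{\mathcal{M}}(x+u)$ is a singleton and, identifying it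 with its only element, $$\|\mathcal{P}_{\mathcal{M}}(x+u)-x-\mathcal{P}_{T_x\mathcal{M}}(u)\|\le Q\|u\|^2 .$$ -/

import Mathlib

open scoped Manifold ContDiff

/-- The space `ℝ^{d × r}` of real `d × r` matrices with the Euclidean (Frobenius) inner product and
norm: the entry of `x` in row `i` and column `j` is `x (i, j)`. -/
abbrev EuclideanMatrix (d r : ℕ) : Type := EuclideanSpace ℝ (Fin d × Fin r)

/-- The nearest-point projection `P_M(x) = argmin_{y ∈ M} ‖y - x‖`, as the set of all minimizers. -/
def metricProjection {E : Type*} [NormedAddCommGroup E] (M : Set E) (x : E) : Set E :=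
  {y | y ∈ M ∧ ∀ z ∈ M, ‖y - x‖ ≤ ‖z - x‖}

/-- A closed set `M` is `R`-proximally smooth if `P_M(x)` is a singleton whenever
`dist(x, M) < R`. -/
def IsProximallySmooth {E : Type*} [NormedAddCommGroup E] (M : Set E) (R : ℝ) : Prop :=
  IsClosed M ∧ ∀ x : E, Metric.infDist x M < R → ∃ p : E, metricProjection M x = {p}

/-- The tangent space `T_x M` of a submanifold `M` of `E`, as a linear subspace of `E`: the image of
the differential at `x` of the inclusion `M → E`. -/
noncomputable def tangentSubspace {E : Type*} [NormedAddCommGroup E] [NormedSpace ℝ E] (m : ℕ)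
    (M : Set E) [ChartedSpace (EuclideanSpace ℝ (Fin m)) M] (x : M) : Submodule ℝ E :=
  LinearMap.range
    (mfderiv (𝓡 m) 𝓘(ℝ, E) (Subtype.val : M → E) x :
      EuclideanSpace ℝ (Fin m) →L[ℝ] E).toLinearMap

/-- `M`, with the smooth structure given on it, is a smooth embedded submanifold of `E` (of
dimension `m`, without boundary): `M` carries the subspace topology, and the inclusion `M → E` is a
smooth embedding. -/
def IsSmoothSubmanifold {E : Type*} [NormedAddCommGroup E] [NormedSpace ℝ E] (m : ℕ)
    (M : Set E) [ChartedSpace (EuclideanSpace ℝ (Fin m)) M] : Prop :=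
  IsManifold (𝓡 m) ∞ M ∧
    Manifold.IsSmoothEmbedding (𝓡 m) 𝓘(ℝ, E) ∞ (Subtype.val : M → E)

open Filter Topology Set
open scoped RealInnerProductSpace

section Projection

variable {E : Type*} [NormedAddCommGroup E] [InnerProductSpace ℝ E]

/-! Let `p` be nearest to `x + u` and `n = x + u - p`. Comparison with `x` gives `‖n‖ ≤ ‖u‖`, hence
`‖p - x‖ ≤ 2‖u‖`, and minimality makes `n` normal to `M` at `p`. With `P` the projection onto `T_x
M`, `p - x - P u = (p - x - P (p - x)) - P n`. The first term is quadratic because `M` leaves its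
tangent space to second order. So is `P n`: `n` is normal at `p`, and tangent spaces vary at a
Lipschitz rate (`norm_starProjection_range_le`). `exists_nhds_norm_sub_starProjection_le` proves
this in a parametrization, and compactness makes the constant uniform. Proximal smoothness serves
only to make the projection a singleton. -/

theorem norm_sub_starProjection_le_of_mem (K : Submodule ℝ E) [K.HasOrthogonalProjection]
    (z : E) {w : E} (hw : w ∈ K) : ‖z - K.starProjection z‖ ≤ ‖z - w‖ := by
  rw [K.starProjection_minimal z]
  exact ciInf_le ⟨0, by rintro _ ⟨y, rfl⟩; positivity⟩ (⟨w, hw⟩ : K)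

theorem norm_starProjection_sq_eq_inner (K : Submodule ℝ E) [K.HasOrthogonalProjection]
    (y : E) : ‖K.starProjection y‖ ^ 2 = ⟪K.starProjection y, y⟫ := by
  have h := K.starProjection_inner_eq_zero y (K.starProjection y)
    (Submodule.starProjection_apply_mem K y)
  rw [inner_sub_left, sub_eq_zero, real_inner_self_eq_norm_sq] at h
  rw [← h, real_inner_comm]

/-- The projection onto the range of `A` of a vector orthogonal to the range of `B` is small if
`A` is bounded below and close to `B`. -/
theorem norm_starProjection_range_le {F : Type*} [NormedAddCommGroup F] [NormedSpace ℝ F]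
    {A B : F →L[ℝ] E} [A.toLinearMap.range.HasOrthogonalProjection] {C δ : ℝ} (hδ : ‖A - B‖ ≤ δ)
    (hC : 0 ≤ C) (hA : ∀ v, ‖v‖ ≤ C * ‖A v‖) {y : E} (hB : ∀ v, ⟪y, B v⟫ = 0) :
    ‖A.toLinearMap.range.starProjection y‖ ≤ δ * C * ‖y‖ := by
  set w := A.toLinearMap.range.starProjection y with hw
  obtain ⟨v, hv⟩ : w ∈ A.toLinearMap.range := Submodule.starProjection_apply_mem _ y
  replace hv : A v = w := hv
  have hδ0 : 0 ≤ δ := (norm_nonneg _).trans hδ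
  -- With `w = A v`, the pairing `⟪w, y⟫` equals `⟪(A - B) v, y⟫`, since `y` is orthogonal to `B v`.
  have hsq : ‖w‖ * ‖w‖ ≤ δ * C * ‖y‖ * ‖w‖ := by
    calc ‖w‖ * ‖w‖ = ⟪w, y⟫ := by
          rw [← sq, hw, norm_starProjection_sq_eq_inner]
      _ = ⟪(A - B) v, y⟫ := by
          rw [sub_apply, inner_sub_left, real_inner_comm y (B v), hB, hv,
            sub_zero]
      _ ≤ ‖(A - B) v‖ * ‖y‖ := real_inner_le_norm _ _
      _ ≤ (δ * (C * ‖w‖)) * ‖y‖ := by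
          gcongr
          exact ((A - B).le_of_opNorm_le hδ v).trans (by gcongr; exact hv ▸ hA v)
      _ = δ * C * ‖y‖ * ‖w‖ := by ring
  rcases (norm_nonneg w).eq_or_lt with h0 | h0
  · rw [← h0]; positivity
  · exact le_of_mul_le_mul_right hsq h0

end Projection

section LocalParametrization

variable {E F : Type*} [NormedAddCommGroup E] [InnerProductSpace ℝ E]
  [NormedAddCommGroup F] [NormedSpace ℝ F]

/-- A `C^1` left inverse bounds a map and its derivative from below. -/
theorem exists_lower_bound_of_leftInverse {φ : F → E} {ψ : E → F} {a₀ : F}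
    (hφ : ContDiffAt ℝ 1 φ a₀) (hψ : ContDiffAt ℝ 1 ψ (φ a₀))
    (hinv : ∀ᶠ a in 𝓝 a₀, ψ (φ a) = a) :
    ∃ C : ℝ, 0 ≤ C ∧ ∃ V ∈ 𝓝 a₀, (∀ a ∈ V, ∀ b ∈ V, ‖a - b‖ ≤ C * ‖φ a - φ b‖) ∧
      ∀ a ∈ V, ∀ v, ‖v‖ ≤ C * ‖fderiv ℝ φ a v‖ := by
  -- The Lipschitz constant of `ψ` also bounds its derivative, so one `C` serves both conclusions.
  obtain ⟨C, T, hT, hC⟩ := hψ.exists_lipschitzOnWith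
  have hev : ∀ᶠ a in 𝓝 a₀, (φ a ∈ interior T ∧ ψ (φ a) = a) ∧
      (∀ᶠ c in 𝓝 a, ψ (φ c) = c) ∧ DifferentiableAt ℝ φ a ∧ DifferentiableAt ℝ ψ (φ a) := by
    refine ((hφ.continuousAt.eventually_mem (interior_mem_nhds.2 hT)).and hinv).and
      (hinv.eventually_nhds.and (.and ?_ ?_))
    · exact (hφ.eventually (by simp)).mono fun a h => h.differentiableAt (by simp)
    · exact (hφ.continuousAt.eventually (hψ.eventually (by simp))).mono
        fun a h => h.differentiableAt (by simp)
  refine ⟨C, C.2, _, hev, ?_, ?_⟩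
  · rintro a ⟨⟨ha, ha'⟩, -⟩ b ⟨⟨hb, hb'⟩, -⟩
    simpa only [ha', hb'] using hC.norm_sub_le (interior_subset ha) (interior_subset hb)
  · rintro a ⟨⟨ha, -⟩, hinv', hφ', hψ'⟩ v
    have hchain : (fderiv ℝ ψ (φ a)).comp (fderiv ℝ φ a) = ContinuousLinearMap.id ℝ F := by
      rw [← fderiv_comp a hψ' hφ']
      exact (EventuallyEq.fderiv_eq hinv').trans fderiv_id
    have hv : fderiv ℝ ψ (φ a) (fderiv ℝ φ a v) = v := congr($hchain v)
    calc ‖v‖ = ‖fderiv ℝ ψ (φ a) (fderiv ℝ φ a v)‖ := by rw [hv]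
      _ ≤ C * ‖fderiv ℝ φ a v‖ := ContinuousLinearMap.le_of_opNorm_le _
          (norm_fderiv_le_of_lipschitzOn ℝ (mem_interior_iff_mem_nhds.1 ha) hC) _

/-- The first-order expansion of the projection onto the image of a `C^2` embedding `φ`: a point
`φ b` such that `φ a + u - φ b` is normal at `φ b` equals `φ a` plus the tangential part of `u`,
up to an error quadratic in `u`. -/
theorem exists_nhds_norm_sub_starProjection_le [FiniteDimensional ℝ F] {φ : F → E} {ψ : E → F}
    {a₀ : F} (hφ : ContDiffAt ℝ 2 φ a₀) (hψ : ContDiffAt ℝ 1 ψ (φ a₀))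
    (hinv : ∀ᶠ a in 𝓝 a₀, ψ (φ a) = a) :
    ∃ K : ℝ, ∃ V ∈ 𝓝 a₀, ∀ a ∈ V, ∀ b ∈ V, ∀ u : E, ‖φ a + u - φ b‖ ≤ ‖u‖ →
      (∀ v, ⟪φ a + u - φ b, fderiv ℝ φ b v⟫ = 0) →
      ‖φ b - φ a - (fderiv ℝ φ a).toLinearMap.range.starProjection u‖ ≤ K * ‖u‖ ^ 2 := by
  obtain ⟨C, hC0, V₁, hV₁, hC₁, hC₂⟩ :=
    exists_lower_bound_of_leftInverse (hφ.of_le (by norm_num)) hψ hinv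
  obtain ⟨L, V₂, hV₂, hL⟩ :=
    (hφ.fderiv_right (m := 1) (by norm_num)).exists_lipschitzOnWith
  have hdiff : ∀ᶠ a in 𝓝 a₀, DifferentiableAt ℝ φ a :=
    (hφ.eventually (by simp)).mono fun a h => h.differentiableAt (by simp)
  obtain ⟨ε, hε, hball⟩ := Metric.mem_nhds_iff.1 (inter_mem (inter_mem hV₁ hV₂) hdiff)
  -- The first summand comes from the Taylor remainder `L‖b - a‖²` with `‖b - a‖ ≤ 2C‖u‖`, the
  -- second from the projected normal vector.
  refine ⟨L * (C * 2) ^ 2 + L * (C * 2) * C, _, Metric.ball_mem_nhds a₀ hε,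
    fun a ha b hb u hu hn => ?_⟩
  have hφab : ‖φ b - φ a‖ ≤ 2 * ‖u‖ := by
    calc ‖φ b - φ a‖ = ‖u - (φ a + u - φ b)‖ := by congr 1; abel
      _ ≤ ‖u‖ + ‖φ a + u - φ b‖ := norm_sub_le _ _
      _ ≤ 2 * ‖u‖ := by linarith
  have hab : ‖b - a‖ ≤ C * 2 * ‖u‖ := by
    refine (hC₁ b (hball hb).1.1 a (hball ha).1.1).trans ?_
    rw [mul_assoc]; gcongr
  have hnormal : ‖φ b - φ a - fderiv ℝ φ a (b - a)‖ ≤ L * ‖b - a‖ * ‖b - a‖ := by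
    have hseg : segment ℝ a b ⊆ Metric.ball a₀ ε := (convex_ball a₀ ε).segment_subset ha hb
    refine Convex.norm_image_sub_le_of_norm_hasFDerivWithin_le' (s := segment ℝ a b)
      (f' := fderiv ℝ φ) (fun x hx => (hball (hseg hx)).2.hasFDerivAt.hasFDerivWithinAt)
      (fun x hx => ?_) (convex_segment a b) (left_mem_segment ℝ a b) (right_mem_segment ℝ a b)
    refine (hL.norm_sub_le (hball (hseg hx)).1.2 (hball ha).1.2).trans ?_
    gcongr
    exact norm_sub_le_of_mem_segment hx
  have htangent := norm_starProjection_range_le (y := φ a + u - φ b)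
    (hL.norm_sub_le (hball ha).1.2 (hball hb).1.2) hC0 (hC₂ a (hball ha).1.1) hn
  set P := (fderiv ℝ φ a).toLinearMap.range.starProjection with hP
  have hsplit : φ b - φ a - P u = (φ b - φ a - P (φ b - φ a)) - P (φ a + u - φ b) := by
    simp only [map_sub, map_add]; abel
  calc ‖φ b - φ a - P u‖ ≤ ‖φ b - φ a - P (φ b - φ a)‖ + ‖P (φ a + u - φ b)‖ := by
        rw [hsplit]; exact norm_sub_le _ _
    _ ≤ L * ‖b - a‖ * ‖b - a‖ + L * ‖b - a‖ * C * ‖u‖ := by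
        refine add_le_add ((norm_sub_starProjection_le_of_mem _ _
          (LinearMap.mem_range_self (fderiv ℝ φ a).toLinearMap (b - a))).trans hnormal) ?_
        rw [norm_sub_rev b a]
        exact htangent.trans (by gcongr)
    _ ≤ L * (C * 2 * ‖u‖) * (C * 2 * ‖u‖) + L * (C * 2 * ‖u‖) * C * ‖u‖ := by gcongr
    _ = (L * (C * 2) ^ 2 + L * (C * 2) * C) * ‖u‖ ^ 2 := by ring

end LocalParametrization

theorem norm_add_sub_le_of_mem_metricProjection {E : Type*} [NormedAddCommGroup E] {M : Set E}
    {x u p : E} (hx : x ∈ M) (hp : p ∈ metricProjection M (x + u)) : ‖x + u - p‖ ≤ ‖u‖ := by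
  have := hp.2 x hx
  rwa [norm_sub_rev, sub_add_cancel_left, norm_neg] at this

section Submanifold

variable {E : Type*} [NormedAddCommGroup E] [InnerProductSpace ℝ E]

/-- The vector from a nearest point `φ b` to `y` is normal to any parametrization `φ`. -/
theorem inner_fderiv_eq_zero_of_mem_metricProjection {F : Type*} [NormedAddCommGroup F]
    [NormedSpace ℝ F] {M : Set E} {φ : F → E} (hφM : ∀ a, φ a ∈ M) {b : F} {y : E}
    (hb : φ b ∈ metricProjection M y) (hφ : DifferentiableAt ℝ φ b) (v : F) :
    ⟪y - φ b, fderiv ℝ φ b v⟫ = 0 := by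
  -- The squared norm is differentiable even where `φ b = y`.
  have hmin : IsLocalMin (fun a => ‖φ a - y‖ ^ 2) b :=
    Eventually.of_forall fun a => pow_le_pow_left₀ (norm_nonneg _) (hb.2 _ (hφM a)) 2
  have hd := (hφ.hasFDerivAt.sub_const y).norm_sq
  have h := congr($(hmin.hasFDerivAt_eq_zero hd) v)
  simp only [smul_apply, ContinuousLinearMap.comp_apply, innerSL_apply_apply,
    zero_apply] at h
  rw [← neg_sub, inner_neg_left, neg_eq_zero]
  simpa using h

variable {m : ℕ} {M : Set E} [ChartedSpace (EuclideanSpace ℝ (Fin m)) M]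

/-- The tangent space is the range of the derivative of the parametrization given by a chart. -/
theorem tangentSubspace_eq_range_fderiv (hM : IsSmoothSubmanifold m M)
    {e : OpenPartialHomeomorph M (EuclideanSpace ℝ (Fin m))}
    (he : e ∈ IsManifold.maximalAtlas (𝓡 m) ∞ M) {x : M} (hx : x ∈ e.source) :
    tangentSubspace m M x =
      (fderiv ℝ (fun a => (e.symm a : E)) (e x)).toLinearMap.range := by
  have := hM.1
  have : IsManifold (𝓡 m) 1 M := IsManifold.of_le (n := ∞) (by simp)
  have he' : e.MDifferentiable (𝓡 m) (𝓡 m) :=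
    ⟨(contMDiffOn_of_mem_maximalAtlas he).mdifferentiableOn (by simp),
      (contMDiffOn_symm_of_mem_maximalAtlas he).mdifferentiableOn (by simp)⟩
  have hval : MDifferentiableAt (𝓡 m) 𝓘(ℝ, E) (Subtype.val : M → E) (e.symm (e x)) :=
    hM.2.contMDiff.mdifferentiable (by simp) _
  have hcomp := mfderiv_comp (e x) hval (he'.mdifferentiableAt_symm (e.map_source hx))
  rw [e.left_inv hx] at hcomp
  rw [← mfderiv_eq_fderiv]
  change _ = LinearMap.range (mfderiv (𝓡 m) 𝓘(ℝ, E) (Subtype.val ∘ e.symm) (e x)).toLinearMap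
  rw [hcomp]
  -- Precomposing with a surjective differential leaves the range unchanged.
  have hsurj := he'.symm.mfderiv_surjective (x := e x) (e.map_source hx)
  exact (LinearMap.range_comp_of_range_eq_top _ (LinearMap.range_eq_top.2 hsurj)).symm

/-- The parametrization of a submanifold by a suitable chart is smooth with a smooth left
inverse. -/
theorem exists_chart_leftInverse (hM : IsSmoothSubmanifold m M) (x₀ : M) :
    ∃ e ∈ IsManifold.maximalAtlas (𝓡 m) ∞ M, x₀ ∈ e.source ∧
      (∀ a ∈ e.target, ContDiffAt ℝ ∞ (fun a => (e.symm a : E)) a) ∧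
      ∃ ψ : E → EuclideanSpace ℝ (Fin m), ContDiffAt ℝ ∞ ψ x₀ ∧
        ∀ a ∈ e.target, ψ (e.symm a) = a := by
  have h := hM.2.isImmersion.isImmersionAt x₀
  -- In charts adapted to the immersion the inclusion reads `a ↦ (a, 0)`, so the first component of
  -- the ambient chart is a left inverse.
  refine ⟨h.domChart, h.domChart_mem_maximalAtlas, h.mem_domChart_source, fun a ha => ?_,
    fun y => (h.equiv.symm (h.codChart y)).1, ?_, fun a ha => ?_⟩
  · exact (hM.2.contMDiff.contMDiffAt.comp a
      (contMDiffAt_symm_of_mem_maximalAtlas h.domChart_mem_maximalAtlas ha)).contDiffAt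
  · have hc := (contMDiffAt_of_mem_maximalAtlas h.codChart_mem_maximalAtlas
      h.mem_codChart_source).contDiffAt
    exact (contDiff_fst.comp h.equiv.symm.contDiff).contDiffAt.comp (x₀ : E) hc
  · have hw := h.writtenInCharts
      (show a ∈ (h.domChart.extend (𝓡 m)).target by simpa [mfld_simps] using ha)
    simp only [Function.comp_apply, mfld_simps] at hw
    simp [hw]

/-- The quadratic estimate for nearest points, near a point of a submanifold. -/
theorem exists_eventually_norm_sub_starProjection_le [FiniteDimensional ℝ E]
    (hM : IsSmoothSubmanifold m M) (x₀ : M) :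
    ∃ K : ℝ, ∃ W ∈ 𝓝 (x₀ : E), ∀ (x p : M), (x : E) ∈ W → (p : E) ∈ W → ∀ u : E,
      (p : E) ∈ metricProjection M (x + u) →
      ‖(p : E) - x - (tangentSubspace m M x).starProjection u‖ ≤ K * ‖u‖ ^ 2 := by
  obtain ⟨e, he, hx₀, hφ, ψ, hψ, hinv⟩ := exists_chart_leftInverse hM x₀
  obtain ⟨K, V, hV, hK⟩ := exists_nhds_norm_sub_starProjection_le
    (φ := fun a => (e.symm a : E)) (ψ := ψ) (a₀ := e x₀)
    ((hφ _ (e.map_source hx₀)).of_le (WithTop.coe_le_coe.2 le_top))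
    (by rw [e.left_inv hx₀]; exact hψ.of_le (by simp))
    (eventually_of_mem (e.open_target.mem_nhds (e.map_source hx₀)) hinv)
  have hnhds : e.source ∩ e ⁻¹' V ∈ 𝓝 x₀ :=
    inter_mem (e.open_source.mem_nhds hx₀) (e.continuousAt hx₀ hV)
  -- Since `M` has the subspace topology, points of `M` close in `E` lie in the same chart.
  obtain ⟨W, hW, hWV⟩ := mem_nhds_induced _ _ _ |>.1 hnhds
  refine ⟨K, W, hW, fun x p hx hp u hpu => ?_⟩
  obtain ⟨hxs, hxV⟩ := hWV hx
  obtain ⟨hps, hpV⟩ := hWV hp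
  have hex : (e.symm (e x) : E) = x := by rw [e.left_inv hxs]
  have hep : (e.symm (e p) : E) = p := by rw [e.left_inv hps]
  have h := hK (e x) hxV (e p) hpV u
  simp only [hex, hep] at h
  simp only [tangentSubspace_eq_range_fderiv hM he hxs]
  refine h (norm_add_sub_le_of_mem_metricProjection x.2 hpu) fun v => ?_
  rw [← hep] at hpu ⊢
  exact inner_fderiv_eq_zero_of_mem_metricProjection (φ := fun a => (e.symm a : E))
    (fun a => (e.symm a).2) hpu
    ((hφ _ (e.map_source hps)).differentiableAt (by simp)) v

/-- The quadratic estimate for nearest points of a compact submanifold. -/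
theorem exists_norm_sub_starProjection_le [FiniteDimensional ℝ E]
    (hM : IsSmoothSubmanifold m M) (hcompact : IsCompact M) :
    ∃ Q : ℝ, ∀ (x : M) (u p : E), p ∈ metricProjection M (x + u) →
      ‖p - x - (tangentSubspace m M x).starProjection u‖ ≤ Q * ‖u‖ ^ 2 := by
  suffices h : ∃ Q : ℝ, ∀ x : M, (x : E) ∈ M → ∀ u p : E, p ∈ metricProjection M (x + u) →
      ‖p - x - (tangentSubspace m M x).starProjection u‖ ≤ Q * ‖u‖ ^ 2 by
    obtain ⟨Q, hQ⟩ := h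
    exact ⟨Q, fun x => hQ x x.2⟩
  refine hcompact.induction_on
    (p := fun s => ∃ Q : ℝ, ∀ x : M, (x : E) ∈ s → ∀ u p : E, p ∈ metricProjection M (x + u) →
      ‖p - x - (tangentSubspace m M x).starProjection u‖ ≤ Q * ‖u‖ ^ 2) ?_ ?_ ?_ ?_
  · exact ⟨0, fun x hx => hx.elim⟩
  · rintro s t hst ⟨Q, hQ⟩
    exact ⟨Q, fun x hx => hQ x (hst hx)⟩
  · rintro s t ⟨Q, hQ⟩ ⟨R, hR⟩
    refine ⟨max Q R, fun x hx u p hp => hx.elim (fun hx => (hQ x hx u p hp).trans ?_)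
      fun hx => (hR x hx u p hp).trans ?_⟩ <;> gcongr
    exacts [le_max_left _ _, le_max_right _ _]
  · intro x₀ hx₀
    obtain ⟨K, W, hW, hK⟩ := exists_eventually_norm_sub_starProjection_le hM ⟨x₀, hx₀⟩
    obtain ⟨ε, hε, hball⟩ := Metric.mem_nhds_iff.1 hW
    refine ⟨_, mem_nhdsWithin_of_mem_nhds (Metric.ball_mem_nhds x₀ (half_pos hε)),
      max K (3 / (ε / 4)), fun x hx u p hp => ?_⟩
    have hu := norm_add_sub_le_of_mem_metricProjection x.2 hp
    have hpx : ‖p - x‖ ≤ 2 * ‖u‖ := by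
      calc ‖p - x‖ = ‖u - (x + u - p)‖ := by congr 1; abel
        _ ≤ ‖u‖ + ‖x + u - p‖ := norm_sub_le _ _
        _ ≤ 2 * ‖u‖ := by linarith
    -- For small `u`, `p` is within `2‖u‖ + ε/2 < ε` of `x₀`, so the local estimate applies.
    -- Otherwise the crude bound `3‖u‖` is already at most `3 / (ε / 4) * ‖u‖ ^ 2`.
    rcases lt_or_ge ‖u‖ (ε / 4) with hsmall | hlarge
    · refine (hK x ⟨p, hp.1⟩ (hball (Metric.ball_subset_ball (by linarith) hx)) (hball ?_)
        u hp).trans (by gcongr; exact le_max_left _ _)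
      rw [Metric.mem_ball] at hx ⊢
      calc dist p x₀ ≤ dist p x + dist (x : E) x₀ := dist_triangle _ _ _
        _ < ε := by rw [dist_eq_norm p]; linarith
    · calc ‖p - x - (tangentSubspace m M x).starProjection u‖
          ≤ ‖p - x‖ + ‖(tangentSubspace m M x).starProjection u‖ := norm_sub_le _ _
        _ ≤ 2 * ‖u‖ + ‖u‖ := add_le_add hpx (Submodule.norm_starProjection_apply_le _ _)
        _ = 3 / (ε / 4) * ((ε / 4) * ‖u‖) := by field_simp; ring
        _ ≤ max K (3 / (ε / 4)) * (‖u‖ * ‖u‖) := by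
          gcongr
          exact le_max_right _ _
        _ = max K (3 / (ε / 4)) * ‖u‖ ^ 2 := by rw [sq]

end Submanifold

theorem mainTheorem3 (d r m : ℕ) (M : Set (EuclideanMatrix d r))
    [ChartedSpace (EuclideanSpace ℝ (Fin m)) M]
    (hM : IsSmoothSubmanifold m M) (hcompact : IsCompact M)
    (γ : ℝ) (hγ : 0 < γ) (hprox : IsProximallySmooth M (2 * γ)) :
    ∃ Q : ℝ, ∀ (x : M) (u : EuclideanMatrix d r), ‖u‖ ≤ γ →
      ∃ p : EuclideanMatrix d r, metricProjection M (x + u) = {p} ∧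
        ‖p - x - (tangentSubspace m M x).starProjection u‖ ≤ Q * ‖u‖ ^ 2 := by
  obtain ⟨Q, hQ⟩ := exists_norm_sub_starProjection_le hM hcompact
  refine ⟨Q, fun x u hu => ?_⟩
  have hdist : Metric.infDist (x + u : EuclideanMatrix d r) M < 2 * γ := by
    calc Metric.infDist (x + u : EuclideanMatrix d r) M ≤ dist (x + u : EuclideanMatrix d r) x :=
          Metric.infDist_le_dist_of_mem x.2
      _ = ‖u‖ := by rw [dist_eq_norm, add_sub_cancel_left]
      _ < 2 * γ := by linarith
  obtain ⟨p, hp⟩ := hprox.2 _ hdist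
  exact ⟨p, hp, hQ x u p (hp ▸ Set.mem_singleton p)⟩
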